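/- Let $r:\mathbb R\to\mathbb R$ be the $1$-periodic function equal to $1$ on $[0,1/2)$ and to $-1$ on $[1/2,1)$, and put $r_j(x)=r(2^jx)$. For an integer $n\ge 0$ with binary expansion $n=\sum_{j\ge 0}\varepsilon_j(n)2^j$, $\varepsilon_j(n)\in\{0,1\}$, let $w_n=\prod_{j\ge 0}r_j^{\varepsilon_j(n)}$ be the $n$-th Walsh function, let $\mathrm{Sp}(n)=\{j:\varepsilon_j(n)=1\}$ be the spectrum of $n$, and let $V(n)=\varepsilon_0(n)+\sum_{j\ge 1}|\varepsilon_j(n)-\varepsilon_{j-1}(n)|$ be the variation of $n$. For $f\in L^1[0,1)$ let $S_n(f)=\sum_{k=0}^{n-1}\hat f(k)\,w_k$, where $\hat f(k)=\int_{[0,1)}f w_k$. An increasing sequence $(n_k)_{k\ge 1}$ of positive integers has nested spectrums if $\mathrm{Sp}(n_{k+1})\cap[0,\max\mathrm{Sp}(n_k)]=\mathrm{Sp}(n_k)$ for every $k$, and unbounded variation if $\sup_k V(n_k)=\infty$. (i) If $(n_k)$ has nested spectrums and unbounded variation, then there is $f\in L^1[0,1)$ such that $\sup_k|S_{n_k}(f)(x)|=\infty$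 for every $x\in[0,1)$. (ii) More generally, let $(m_k)_{k\ge 1}$ be a sequence of non-negative integers that contains a subsequence $(m_{j_k})_{k\ge 1}$, $j_1<j_2<\cdots$, for which $(|m_{j_k}-n_k|)_{k\ge 1}$ is bounded for some sequence $(n_k)$ with nested spectrums and unbounded variation. Then there is $f\in L^1[0,1)$ such that $\sup_k|S_{m_k}(f)(x)|=\infty$ for every $x\in[0,1)$. (iii) For every sequence $(\lambda_k)_{k\ge 1}$ of positive numbers there are $f\in L^1[0,1)$ and an increasing sequence $(n_k)_{k\ge 1}$ of positive integers such that $n_{k+1}/n_k\ge\lambda_k$ for every $k$ and $\sup_k|S_{n_k}(f)(x)|=\infty$ for every $x\in[0,1)$. -/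

import Mathlib

open Set MeasureTheory

namespace Walsh

/-- The `j`-th binary coefficient of `n`. -/
def binCoeff (j n : ℕ) : ℕ := n / 2 ^ j % 2

/-- All binary coefficients of `n` of index at least `n` vanish; hence in the definitions below the
sums and products over all `j` may be truncated to `j < n`. -/
theorem binCoeff_eq_zero {j n : ℕ} (h : n ≤ j) : binCoeff j n = 0 := by
  have h1 : n < 2 ^ j := lt_of_le_of_lt h Nat.lt_two_pow_self
  simp [binCoeff, Nat.div_eq_of_lt h1]

/-- The spectrum of `n`: the set of all `j` such that the `j`-th binary coefficient of `n` is 1. -/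
def spectrum (n : ℕ) : Finset ℕ := (Finset.range n).filter fun j => binCoeff j n = 1

theorem mem_spectrum {j n : ℕ} : j ∈ spectrum n ↔ binCoeff j n = 1 := by
  constructor
  · intro h
    exact (Finset.mem_filter.1 h).2
  · intro h
    refine Finset.mem_filter.2 ⟨Finset.mem_range.2 ?_, h⟩
    by_contra hc
    rw [binCoeff_eq_zero (not_lt.1 hc)] at h
    exact zero_ne_one h

/-- The largest element of the spectrum of `n` (used for positive `n` only). -/
def maxSpectrum (n : ℕ) : ℕ := (spectrum n).sup id

/-- The variation of `n`: the zeroth binary coefficient plus the sum of `|ε_{j+1} - ε_j|` over all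
`j ≥ 0` (the terms with `j ≥ n` vanish). -/
def variation (n : ℕ) : ℤ :=
  (binCoeff 0 n : ℤ) +
    ∑ j ∈ Finset.range n, |(binCoeff (j + 1) n : ℤ) - (binCoeff j n : ℤ)|

/-- Increasing sequences of positive integers with nested spectrums. -/
structure NestedSpectrums (n : ℕ → ℕ) : Prop where
  pos : ∀ k, 0 < n k
  strictMono : StrictMono n
  nested : ∀ k, spectrum (n (k + 1)) ∩ Finset.Icc 0 (maxSpectrum (n k)) = spectrum (n k)

/-- The sequence of variations is unbounded. -/
def UnboundedVariation (n : ℕ → ℕ) : Prop :=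
  ¬ BddAbove (range fun k => variation (n k))

/-- The sequences `m` and `n` are close: `|m k - n k|` is bounded. -/
def Close (m n : ℕ → ℕ) : Prop := ∃ C : ℤ, ∀ k, |(m k : ℤ) - (n k : ℤ)| ≤ C

noncomputable section

/-- The 1-periodic function equal to `1` on `[0, 1/2)` and to `-1` on `[1/2, 1)`. -/
def rademacherBase (x : ℝ) : ℝ := if Int.fract x < 1 / 2 then 1 else -1

/-- The Rademacher functions. -/
def rademacher (j : ℕ) (x : ℝ) : ℝ := rademacherBase (2 ^ j * x)

/-- The Walsh functions (in the Paley ordering); the factors with `j ≥ n` are `1`. -/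
def walsh (n : ℕ) (x : ℝ) : ℝ := ∏ j ∈ Finset.range n, rademacher j x ^ binCoeff j n

/-- The Walsh-Fourier coefficients. -/
def coeff (f : ℝ → ℝ) (k : ℕ) : ℝ := ∫ t in Ico (0 : ℝ) 1, f t * walsh k t

/-- The partial sums `∑_{k < n}` of the Walsh-Fourier series. -/
def partialSum (n : ℕ) (f : ℝ → ℝ) (x : ℝ) : ℝ :=
  ∑ k ∈ Finset.range n, coeff f k * walsh k x

/-- `sup_k |S_{n_k}(f)(x)| = ∞` for every `x ∈ [0, 1)`. -/
def UnboundedEverywhereAlong (n : ℕ → ℕ) (f : ℝ → ℝ) : Prop :=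
  ∀ x ∈ Ico (0 : ℝ) 1, ¬ BddAbove (range fun k => |partialSum (n k) f x|)

end

end Walsh

namespace Walsh

/-! A point is encoded by its sequence of Rademacher signs, and translation becomes multiplication
of sign sequences. If the first sign `-1` of `ρ` has index `m`, then `dirichlet n ρ` is `chi n ρ`
times a residue depending only on the digits of `n` up to `m` (`dirichlet_eq_chi_mul`). The residue
is large wherever the digits jump, so the mean of its modulus over dyadic cells is at least about a
quarter of the variation.

To exploit this, fix `n k` of large variation and put one point mass in each of the `2 ^ Q` cells
determined by its digits. Later members of the sequence share these digits, hence these residues,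
but each has a new top digit. The free higher signs of the points can thus be tuned so that, for any
cell `s`, some later index makes all kernels centred in the other cells contribute with the same
sign at every point of `s` (`NestedSpectrums.exists_points`). No cancellation remains, and the
partial sums of this probability measure are large everywhere.

Cutting the measure off at a power of two gives nonnegative Walsh polynomials of integral `1`
(`NestedSpectrums.exists_walshPoly`), and a gliding hump sums them to an integrable function
(`NestedSpectrums.exists_unboundedEverywhere`). Bounded changes of the index cost only a multiple of
the `L¹` norm, and adding ever higher powers of two yields sparse nested sequences. -/

theorem binCoeff_zero_left (n : ℕ) : binCoeff 0 n = n % 2 := by simp [binCoeff]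

theorem binCoeff_succ (j n : ℕ) : binCoeff (j + 1) n = binCoeff j (n / 2) := by
  simp only [binCoeff]
  rw [Nat.div_div_eq_div_mul, pow_succ']

theorem binCoeff_eq_zero_or_one (j n : ℕ) : binCoeff j n = 0 ∨ binCoeff j n = 1 :=
  Nat.mod_two_eq_zero_or_one _

theorem binCoeff_eq_zero_of_notMem {j n : ℕ} (h : j ∉ spectrum n) : binCoeff j n = 0 :=
  (binCoeff_eq_zero_or_one j n).resolve_right fun h1 => h (mem_spectrum.2 h1)

theorem binCoeff_eq_of_mem_iff {j a b : ℕ} (h : j ∈ spectrum a ↔ j ∈ spectrum b) :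
    binCoeff j a = binCoeff j b := by
  rw [mem_spectrum, mem_spectrum] at h
  rcases binCoeff_eq_zero_or_one j a with ha | ha <;>
    rcases binCoeff_eq_zero_or_one j b with hb | hb <;> simp_all

theorem eq_of_binCoeff_eq {a b : ℕ} (h : ∀ j, binCoeff j a = binCoeff j b) : a = b := by
  apply Nat.eq_of_testBit_eq
  intro j
  rw [Nat.testBit_eq_decide_div_mod_eq, Nat.testBit_eq_decide_div_mod_eq]
  have := h j
  simp only [binCoeff] at this
  rw [this]

/-! ### Characters of sign sequences -/

/-- A sequence with values `1` and `-1`. -/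
def IsSign (ρ : ℕ → ℝ) : Prop := ∀ j, ρ j = 1 ∨ ρ j = -1

/-- The product of `ρ j` over the spectrum of `n`. -/
noncomputable def chi (n : ℕ) (ρ : ℕ → ℝ) : ℝ := ∏ j ∈ Finset.range n, ρ j ^ binCoeff j n

theorem chi_eq_prod_range {n L : ℕ} (h : n ≤ L) (ρ : ℕ → ℝ) :
    chi n ρ = ∏ j ∈ Finset.range L, ρ j ^ binCoeff j n := by
  apply Finset.prod_subset (Finset.range_mono h)
  intro j _ hj
  rw [binCoeff_eq_zero (by simpa using hj), pow_zero]

theorem chi_eq_prod_spectrum (n : ℕ) (ρ : ℕ → ℝ) : chi n ρ = ∏ j ∈ spectrum n, ρ j := by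
  rw [spectrum, Finset.prod_filter]
  apply Finset.prod_congr rfl
  intro j _
  rcases binCoeff_eq_zero_or_one j n with h | h <;> simp [h]

@[simp] theorem chi_zero (ρ : ℕ → ℝ) : chi 0 ρ = 1 := by simp [chi]

theorem chi_eq_mul (n : ℕ) (ρ : ℕ → ℝ) :
    chi n ρ = ρ 0 ^ (n % 2) * chi (n / 2) (fun j => ρ (j + 1)) := by
  rcases n with _ | n
  · simp
  · rw [chi, Finset.prod_range_succ', mul_comm, binCoeff_zero_left,
      chi_eq_prod_range (n := (n + 1) / 2) (L := n) (by omega)]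
    simp only [binCoeff_succ]

theorem chi_two_mul (n : ℕ) (ρ : ℕ → ℝ) : chi (2 * n) ρ = chi n (fun j => ρ (j + 1)) := by
  rw [chi_eq_mul]; simp

theorem chi_two_mul_add_one (n : ℕ) (ρ : ℕ → ℝ) :
    chi (2 * n + 1) ρ = ρ 0 * chi n (fun j => ρ (j + 1)) := by
  rw [chi_eq_mul, show (2 * n + 1) % 2 = 1 by omega, show (2 * n + 1) / 2 = n by omega, pow_one]

theorem chi_mul (n : ℕ) (ρ τ : ℕ → ℝ) : chi n (fun j => ρ j * τ j) = chi n ρ * chi n τ := by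
  simp only [chi, mul_pow, Finset.prod_mul_distrib]

theorem IsSign.mul {ρ τ : ℕ → ℝ} (h : IsSign ρ) (h' : IsSign τ) :
    IsSign (fun j => ρ j * τ j) := by
  intro j
  rcases h j with h | h <;> rcases h' j with h' | h' <;> simp [h, h']

theorem IsSign.chi {ρ : ℕ → ℝ} (h : IsSign ρ) (n : ℕ) : chi n ρ = 1 ∨ chi n ρ = -1 := by
  rw [chi_eq_prod_spectrum]
  induction spectrum n using Finset.induction_on with
  | empty => simp
  | insert a s ha ih =>
    rw [Finset.prod_insert ha]
    rcases h a with h | h <;> rcases ih with ih | ih <;> simp [h, ih]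

theorem IsSign.abs_chi {ρ : ℕ → ℝ} (h : IsSign ρ) (n : ℕ) : |Walsh.chi n ρ| = 1 := by
  rcases h.chi n with h | h <;> simp [h]

/-- The Walsh–Dirichlet kernel as a function of a sign sequence. -/
noncomputable def dirichlet (n : ℕ) (ρ : ℕ → ℝ) : ℝ := ∑ k ∈ Finset.range n, chi k ρ

theorem dirichlet_two_mul (n : ℕ) (ρ : ℕ → ℝ) :
    dirichlet (2 * n) ρ = (1 + ρ 0) * dirichlet n (fun j => ρ (j + 1)) := by
  induction n with
  | zero => simp [dirichlet]
  | succ n ih =>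
    simp only [dirichlet] at ih ⊢
    rw [show 2 * (n + 1) = 2 * n + 1 + 1 by ring, Finset.sum_range_succ, Finset.sum_range_succ, ih,
      chi_two_mul, chi_two_mul_add_one, Finset.sum_range_succ]
    ring

theorem dirichlet_two_mul_add_one (n : ℕ) (ρ : ℕ → ℝ) :
    dirichlet (2 * n + 1) ρ =
      (1 + ρ 0) * dirichlet n (fun j => ρ (j + 1)) + chi n (fun j => ρ (j + 1)) := by
  rw [← chi_two_mul, ← dirichlet_two_mul, dirichlet, Finset.sum_range_succ]; rfl

/-- Each doubling of the length splits off a factor `1 + ρ j`, which is `0` or `2`. -/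
theorem dirichlet_two_pow_nonneg (R : ℕ) {ρ : ℕ → ℝ} (h : IsSign ρ) :
    0 ≤ dirichlet (2 ^ R) ρ := by
  induction R generalizing ρ with
  | zero => simp [dirichlet]
  | succ R ih =>
    rw [pow_succ', dirichlet_two_mul]
    apply mul_nonneg
    · rcases h 0 with h | h <;> rw [h] <;> norm_num
    · exact ih fun j => h (j + 1)

/-- The modulus of the Dirichlet kernel up to sign, at points whose first sign `-1` is the one of
index `m`: the residue of `n` modulo `2 ^ (m + 1)` in `[-2 ^ m, 2 ^ m)`. -/
noncomputable def balancedResidue (m n : ℕ) : ℝ :=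
  ((n % 2 ^ m : ℕ) : ℝ) - (binCoeff m n : ℝ) * 2 ^ m

theorem balancedResidue_zero (n : ℕ) : balancedResidue 0 n = -((n % 2 : ℕ) : ℝ) := by
  simp [balancedResidue, binCoeff_zero_left, Nat.mod_one]

theorem balancedResidue_succ (m n : ℕ) :
    balancedResidue (m + 1) n = 2 * balancedResidue m (n / 2) + ((n % 2 : ℕ) : ℝ) := by
  have h : n % 2 ^ (m + 1) = n % 2 + 2 * (n / 2 % 2 ^ m) := by
    rw [pow_succ', Nat.mod_mul]
  simp only [balancedResidue, binCoeff_succ, h, Nat.cast_add, Nat.cast_mul, Nat.cast_ofNat]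
  ring

/-- This lets residues be transferred between members of a nested sequence. -/
theorem balancedResidue_congr {m a b : ℕ} (h : ∀ j ≤ m, binCoeff j a = binCoeff j b) :
    balancedResidue m a = balancedResidue m b := by
  induction m generalizing a b with
  | zero =>
    have := h 0 le_rfl
    simp only [binCoeff_zero_left] at this
    rw [balancedResidue_zero, balancedResidue_zero, this]
  | succ m ih =>
    have h0 := h 0 (Nat.zero_le _)
    simp only [binCoeff_zero_left] at h0
    rw [balancedResidue_succ, balancedResidue_succ, h0, ih]
    intro j hj
    rw [← binCoeff_succ, ← binCoeff_succ]
    exact h _ (by omega)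

theorem binCoeff_eq_one_of_balancedResidue_neg {m n : ℕ} (h : balancedResidue m n < 0) :
    binCoeff m n = 1 := by
  rcases binCoeff_eq_zero_or_one m n with h0 | h0
  · rw [balancedResidue, h0] at h
    have : (0 : ℝ) ≤ ((n % 2 ^ m : ℕ) : ℝ) := Nat.cast_nonneg _
    simp only [Nat.cast_zero, zero_mul, sub_zero] at h
    linarith
  · exact h0

/-- Induction on `m`, peeling off the lowest digit of `n`. In the base case consecutive characters
cancel in pairs, and only the last one survives, for odd `n`. -/
theorem dirichlet_eq_chi_mul {m : ℕ} {ρ : ℕ → ℝ} (h1 : ∀ j < m, ρ j = 1) (hm : ρ m = -1) (n : ℕ) :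
    dirichlet n ρ = chi n ρ * balancedResidue m n := by
  induction m generalizing ρ n with
  | zero =>
    rw [balancedResidue_zero]
    obtain ⟨q, rfl | rfl⟩ := Nat.even_or_odd' n
    · rw [dirichlet_two_mul, hm]; simp
    · rw [dirichlet_two_mul_add_one, chi_two_mul_add_one, hm,
        show (2 * q + 1) % 2 = 1 by omega]
      simp
  | succ m ih =>
    have ih' := ih (ρ := fun j => ρ (j + 1)) (fun j hj => h1 (j + 1) (by omega)) hm
    have h0 := h1 0 (by omega)
    rw [balancedResidue_succ]
    obtain ⟨q, rfl | rfl⟩ := Nat.even_or_odd' n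
    · rw [dirichlet_two_mul, h0, ih', chi_two_mul, show 2 * q / 2 = q by omega,
        show 2 * q % 2 = 0 by omega]
      push_cast; ring
    · rw [dirichlet_two_mul_add_one, h0, ih', chi_two_mul_add_one, h0,
        show (2 * q + 1) / 2 = q by omega, show (2 * q + 1) % 2 = 1 by omega]
      push_cast; ring

theorem chi_of_forall_eq_one {ρ : ℕ → ℝ} (h : ∀ j, ρ j = 1) (n : ℕ) : chi n ρ = 1 := by
  simp [chi, h]

theorem dirichlet_of_forall_eq_one {ρ : ℕ → ℝ} (h : ∀ j, ρ j = 1) (n : ℕ) :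
    dirichlet n ρ = n := by
  simp [dirichlet, chi_of_forall_eq_one h]

/-- If the digits at `m` and `m + 1` are `1, 0`, the residue is at least `2 ^ m`; if they are `0,
1`, it is a number below `2 ^ m` minus `2 ^ (m + 1)`. -/
theorem abs_sub_mul_le_abs_balancedResidue (m n : ℕ) :
    |(binCoeff (m + 1) n : ℝ) - binCoeff m n| * 2 ^ m ≤ |balancedResidue (m + 1) n| := by
  have h : n % 2 ^ (m + 1) = n % 2 ^ m + 2 ^ m * binCoeff m n := by
    rw [pow_succ, Nat.mod_mul]; rfl
  have hlt : ((n % 2 ^ m : ℕ) : ℝ) < 2 ^ m := by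
    exact_mod_cast Nat.mod_lt n (by positivity : 2 ^ m > 0)
  have h0 : (0 : ℝ) ≤ ((n % 2 ^ m : ℕ) : ℝ) := Nat.cast_nonneg _
  rw [balancedResidue, h]
  push_cast at *
  rw [pow_succ]
  rcases binCoeff_eq_zero_or_one m n with h1 | h1 <;>
    rcases binCoeff_eq_zero_or_one (m + 1) n with h2 | h2 <;> rw [h1, h2] <;> norm_num
  · rw [abs_of_nonpos (by linarith)]; linarith
  · rw [abs_of_nonneg (by positivity)]; linarith

/-! ### Nested spectrums -/

theorem le_maxSpectrum {j n : ℕ} (h : j ∈ spectrum n) : j ≤ maxSpectrum n :=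
  Finset.le_sup (f := id) h

theorem maxSpectrum_mem {n : ℕ} (h : 0 < n) : maxSpectrum n ∈ spectrum n := by
  have hne : (spectrum n).Nonempty := by
    rw [Finset.nonempty_iff_ne_empty]
    intro he
    have : n = 0 := by
      apply eq_of_binCoeff_eq
      intro j
      rw [binCoeff_eq_zero_of_notMem (by simp [he]), binCoeff_eq_zero (Nat.zero_le _)]
    omega
  obtain ⟨j, hj, h⟩ := Finset.exists_mem_eq_sup _ hne id
  rw [maxSpectrum, h]
  exact hj

theorem maxSpectrum_lt {n : ℕ} (h : 0 < n) : maxSpectrum n < n :=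
  Finset.mem_range.1 (Finset.mem_filter.1 (maxSpectrum_mem h)).1

namespace NestedSpectrums

variable {n : ℕ → ℕ}

/-- Otherwise the intersection in the nesting condition removes nothing, and two consecutive terms
coincide. -/
theorem maxSpectrum_lt_succ (h : NestedSpectrums n) (k : ℕ) :
    maxSpectrum (n k) < maxSpectrum (n (k + 1)) := by
  by_contra hlt
  have hs : spectrum (n (k + 1)) = spectrum (n k) := by
    rw [← h.nested k, eq_comm, Finset.inter_eq_left]
    intro j hj
    have := le_maxSpectrum hj
    simp only [Finset.mem_Icc]
    omega
  have := h.strictMono (Nat.lt_succ_self k)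
  have heq : n (k + 1) = n k := eq_of_binCoeff_eq fun j => binCoeff_eq_of_mem_iff (by rw [hs])
  simp only [Nat.succ_eq_add_one] at this
  omega

theorem strictMono_maxSpectrum (h : NestedSpectrums n) :
    StrictMono fun k => maxSpectrum (n k) :=
  strictMono_nat_of_lt_succ h.maxSpectrum_lt_succ

theorem mem_iff (h : NestedSpectrums n) {k l j : ℕ} (hkl : k ≤ l) (hj : j ≤ maxSpectrum (n k)) :
    j ∈ spectrum (n l) ↔ j ∈ spectrum (n k) := by
  induction l, hkl using Nat.le_induction with
  | base => rfl
  | succ l hkl ih =>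
    have := h.strictMono_maxSpectrum.monotone hkl
    rw [← ih, ← h.nested l]
    simp only [Finset.mem_inter, Finset.mem_Icc] at *
    constructor
    · exact fun h => ⟨h, by omega⟩
    · exact fun h => h.1

theorem binCoeff_eq (h : NestedSpectrums n) {k l j : ℕ} (hkl : k ≤ l)
    (hj : j ≤ maxSpectrum (n k)) : binCoeff j (n l) = binCoeff j (n k) :=
  binCoeff_eq_of_mem_iff (h.mem_iff hkl hj)

/-- The signs beyond the spectrum of `n k` can be chosen so that the characters take prescribed
values. -/
theorem exists_isSign_chi_eq (h : NestedSpectrums n) (k : ℕ) {τ : ℕ → ℝ} (hτ : IsSign τ)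
    {σ : ℕ → ℝ} (hσ : IsSign σ) (P : ℕ) :
    ∃ τ' : ℕ → ℝ, IsSign τ' ∧ (∀ j ≤ maxSpectrum (n k), τ' j = τ j) ∧
      ∀ p < P, chi (n (k + 1 + p)) τ' = σ p := by
  induction P with
  | zero => exact ⟨τ, hτ, fun _ _ => rfl, by simp⟩
  | succ P ih =>
    obtain ⟨τ', h1, h2, h3⟩ := ih
    by_cases hc : chi (n (k + 1 + P)) τ' = σ P
    · refine ⟨τ', h1, h2, fun p hp => ?_⟩
      rcases Nat.lt_succ_iff_lt_or_eq.1 hp with hp | rfl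
      exacts [h3 p hp, hc]
    · set M := maxSpectrum (n (k + 1 + P)) with hM
      -- The top index `M` lies beyond the spectra of all earlier terms, so flipping this sign
      -- changes the new character and none of those already arranged.
      refine ⟨Function.update τ' M (-τ' M), ?_, ?_, ?_⟩
      · intro j
        by_cases hj : j = M
        · subst hj
          rcases h1 M with h | h <;> simp [h]
        · simpa [hj] using h1 j
      · intro j hj
        have : maxSpectrum (n k) < M := h.strictMono_maxSpectrum (by omega)
        rw [Function.update_of_ne (by omega), h2 j hj]
      · intro p hp
        rcases Nat.lt_succ_iff_lt_or_eq.1 hp with hp | rfl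
        · rw [← h3 p hp, chi_eq_prod_spectrum, chi_eq_prod_spectrum]
          apply Finset.prod_congr rfl
          intro j hj
          have h4 := le_maxSpectrum hj
          have : maxSpectrum (n (k + 1 + p)) < M := h.strictMono_maxSpectrum (by omega)
          rw [Function.update_of_ne (by omega)]
        · have hmem : M ∈ spectrum (n (k + 1 + p)) := maxSpectrum_mem (h.pos _)
          have : chi (n (k + 1 + p)) (Function.update τ' M (-τ' M)) =
              -chi (n (k + 1 + p)) τ' := by
            rw [chi_eq_prod_spectrum, chi_eq_prod_spectrum, Finset.prod_update_of_mem hmem,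
              neg_mul, ← Finset.mul_prod_erase _ _ hmem, Finset.sdiff_singleton_eq_erase]
          rw [this]
          rcases h1.chi (n (k + 1 + p)) with h5 | h5 <;> rcases hσ p with h6 | h6 <;>
            simp_all

end NestedSpectrums

/-- The `2` pays for the zeroth digit and for the final drop after the top digit. -/
theorem variation_le {n : ℕ} (hn : 0 < n) :
    (variation n : ℝ) ≤
      2 + ∑ j ∈ Finset.range (maxSpectrum n), |(binCoeff (j + 1) n : ℝ) - binCoeff j n| := by
  have h0 : ∀ j, (binCoeff j n : ℝ) = 0 ∨ (binCoeff j n : ℝ) = 1 := fun j => by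
    rcases binCoeff_eq_zero_or_one j n with h | h <;> simp [h]
  have h1 : ∑ j ∈ Finset.range n, |(binCoeff (j + 1) n : ℝ) - binCoeff j n| =
      ∑ j ∈ Finset.range (maxSpectrum n + 1), |(binCoeff (j + 1) n : ℝ) - binCoeff j n| := by
    symm
    apply Finset.sum_subset (Finset.range_mono (maxSpectrum_lt hn))
    intro j _ hj
    have hz : ∀ i, maxSpectrum n < i → binCoeff i n = 0 := fun i hi =>
      binCoeff_eq_zero_of_notMem fun hmem => by have := le_maxSpectrum hmem; omega
    simp only [Finset.mem_range, not_lt] at hj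
    rw [hz j (by omega), hz (j + 1) (by omega)]
    simp
  rw [variation]
  push_cast
  rw [h1, Finset.sum_range_succ]
  have h2 : |(binCoeff (maxSpectrum n + 1) n : ℝ) - binCoeff (maxSpectrum n) n| ≤ 1 := by
    rcases h0 (maxSpectrum n + 1) with h | h <;> rcases h0 (maxSpectrum n) with h' | h' <;>
      rw [h, h'] <;> norm_num
  rcases h0 0 with h | h <;> linarith

/-! ### Averages over dyadic cells -/

/-- The signs of the cell with label `i`. -/
noncomputable def cellSign (i j : ℕ) : ℝ := (-1) ^ binCoeff j i

theorem isSign_cellSign (i : ℕ) : IsSign (cellSign i) := fun _ => neg_one_pow_eq_or ℝ _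

theorem exists_cellSign_eq (Q : ℕ) {ρ : ℕ → ℝ} (h : IsSign ρ) :
    ∃ s < 2 ^ Q, ∀ j < Q, cellSign s j = ρ j := by
  induction Q generalizing ρ with
  | zero => exact ⟨0, by simp, by simp⟩
  | succ Q ih =>
    obtain ⟨s, hs, h1⟩ := ih (ρ := fun j => ρ (j + 1)) fun j => h (j + 1)
    have hb : ∃ b < 2, (-1 : ℝ) ^ b = ρ 0 := by
      rcases h 0 with h | h
      · exact ⟨0, by simp [h]⟩
      · exact ⟨1, by simp [h]⟩
    obtain ⟨b, hb, h0⟩ := hb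
    refine ⟨2 * s + b, by rw [pow_succ]; omega, fun j hj => ?_⟩
    rcases j with _ | j
    · rw [cellSign, binCoeff_zero_left, show (2 * s + b) % 2 = b by omega, h0]
    · rw [cellSign, binCoeff_succ, show (2 * s + b) / 2 = s by omega]
      exact h1 j (by omega)

theorem sum_range_two_mul (G : ℕ → ℝ) (n : ℕ) :
    ∑ i ∈ Finset.range (2 * n), G i =
      ∑ i ∈ Finset.range n, G (2 * i) + ∑ i ∈ Finset.range n, G (2 * i + 1) := by
  induction n with
  | zero => simp
  | succ n ih =>
    rw [show 2 * (n + 1) = 2 * n + 1 + 1 by ring]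
    simp only [Finset.sum_range_succ, ih]
    ring

/-- Exactly `2 ^ Q / 2 ^ (m + 1)` labels first differ from `s` at digit `m`. The induction splits
labels by parity: one half differs from `s` at digit `0`, the other is the same problem for `s / 2`.
-/
theorem sum_le_sum_range_two_pow {Q s : ℕ} (hs : s < 2 ^ Q) {g G : ℕ → ℝ} (h0 : 0 ≤ G s)
    (h : ∀ m < Q, ∀ i < 2 ^ Q, (∀ j < m, binCoeff j i = binCoeff j s) →
      binCoeff m i ≠ binCoeff m s → g m ≤ G i) :
    ∑ m ∈ Finset.range Q, 2 ^ Q / 2 ^ (m + 1) * g m ≤ ∑ i ∈ Finset.range (2 ^ Q), G i := by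
  induction Q generalizing s g G with
  | zero =>
    have : s = 0 := by simpa using hs
    subst this
    simpa using h0
  | succ Q ih =>
    have key : ∀ a b, a < 2 → b < 2 → a ≠ b → s % 2 = a →
        ∑ m ∈ Finset.range (Q + 1), 2 ^ (Q + 1) / 2 ^ (m + 1) * g m ≤
        ∑ i ∈ Finset.range (2 ^ Q), G (2 * i + a) + ∑ i ∈ Finset.range (2 ^ Q), G (2 * i + b) := by
      intro a b ha hb hab hsa
      have h1 := ih (s := s / 2) (g := fun m => g (m + 1)) (G := fun i => G (2 * i + a))
        (by rw [pow_succ] at hs; omega) (by rwa [show 2 * (s / 2) + a = s by omega])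
        (by
          intro m hm i hi hlt hne
          apply h (m + 1) (by omega) (2 * i + a) (by rw [pow_succ]; omega)
          · intro j hj
            rcases j with _ | j
            · rw [binCoeff_zero_left, binCoeff_zero_left]; omega
            · rw [binCoeff_succ, binCoeff_succ, show (2 * i + a) / 2 = i by omega]
              exact hlt j (by omega)
          · rwa [binCoeff_succ, binCoeff_succ, show (2 * i + a) / 2 = i by omega])
      have h2 : ∑ i ∈ Finset.range (2 ^ Q), g 0 ≤ ∑ i ∈ Finset.range (2 ^ Q), G (2 * i + b) := by
        apply Finset.sum_le_sum
        intro i hi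
        have hi' := Finset.mem_range.1 hi
        apply h 0 (by omega) _ (by rw [pow_succ]; omega) (by simp)
        rw [binCoeff_zero_left, binCoeff_zero_left]; omega
      rw [Finset.sum_range_succ']
      simp only [Finset.sum_const, Finset.card_range, nsmul_eq_mul, Nat.cast_pow,
        Nat.cast_ofNat] at h2
      have h3 : (2 : ℝ) ^ (Q + 1) / 2 ^ (0 + 1) * g 0 = 2 ^ Q * g 0 := by
        rw [pow_succ]; ring
      have h4 : ∀ m : ℕ, (2 : ℝ) ^ (Q + 1) / 2 ^ (m + 1 + 1) = 2 ^ Q / 2 ^ (m + 1) := fun m => by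
        rw [pow_succ, pow_succ (2 : ℝ) (m + 1), mul_div_mul_right _ _ (by norm_num)]
      rw [h3]
      simp only [h4]
      linarith
    rw [show (2 : ℕ) ^ (Q + 1) = 2 * 2 ^ Q from pow_succ' 2 Q, sum_range_two_mul]
    rcases Nat.mod_two_eq_zero_or_one s with h1 | h1
    · simpa using key 0 1 (by omega) (by omega) (by omega) h1
    · rw [add_comm (∑ i ∈ Finset.range (2 ^ Q), G (2 * i))]
      simpa using key 1 0 (by omega) (by omega) (by omega) h1

/-- The first index at which the cells with labels `s` and `i` differ. -/
noncomputable def firstDiff (s i : ℕ) : ℕ := sInf {j | binCoeff j i ≠ binCoeff j s}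

theorem firstDiff_eq {s i m : ℕ} (h : ∀ j < m, binCoeff j i = binCoeff j s)
    (hm : binCoeff m i ≠ binCoeff m s) : firstDiff s i = m := by
  apply le_antisymm (Nat.sInf_le hm)
  by_contra! hlt
  exact Nat.sInf_mem (s := {j | binCoeff j i ≠ binCoeff j s}) ⟨m, hm⟩ (h _ hlt)

theorem sum_abs_sub_le_sum_balancedResidue (n M : ℕ) :
    2 ^ (M + 1) / 4 * ∑ j ∈ Finset.range M, |(binCoeff (j + 1) n : ℝ) - binCoeff j n| ≤
      ∑ m ∈ Finset.range (M + 1), 2 ^ (M + 1) / 2 ^ (m + 1) * |balancedResidue m n| := by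
  rw [Finset.sum_range_succ', Finset.mul_sum]
  have h : ∑ j ∈ Finset.range M,
      2 ^ (M + 1) / 4 * |(binCoeff (j + 1) n : ℝ) - binCoeff j n| ≤
      ∑ m ∈ Finset.range M,
        2 ^ (M + 1) / 2 ^ (m + 1 + 1) * |balancedResidue (m + 1) n| := by
    apply Finset.sum_le_sum
    intro m _
    calc (2 : ℝ) ^ (M + 1) / 4 * |(binCoeff (m + 1) n : ℝ) - binCoeff m n|
        = 2 ^ (M + 1) / 2 ^ (m + 1 + 1) *
          (|(binCoeff (m + 1) n : ℝ) - binCoeff m n| * 2 ^ m) := by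
            rw [pow_succ 2 (m + 1), pow_succ 2 m]; field_simp; ring
      _ ≤ _ := by gcongr; exact abs_sub_mul_le_abs_balancedResidue m n
  have h' : (0 : ℝ) ≤ 2 ^ (M + 1) / 2 ^ (0 + 1) * |balancedResidue 0 n| := by positivity
  linarith

/-- Finitely many points such that the averages of the Dirichlet kernels centred at these points
are large everywhere. -/
theorem NestedSpectrums.exists_points {n : ℕ → ℕ} (h : NestedSpectrums n)
    (hv : UnboundedVariation n) (A : ℝ) :
    ∃ (N : ℕ) (τ : ℕ → ℕ → ℝ) (K : ℕ), 0 < N ∧ (∀ i, IsSign (τ i)) ∧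
      ∀ ρ, IsSign ρ → ∃ k ≤ K,
        A * N ≤ |∑ i ∈ Finset.range N, dirichlet (n k) (fun j => τ i j * ρ j)| := by
  -- The `2` is the loss in `variation_le`, the factor `4` the loss in
  -- `sum_abs_sub_le_sum_balancedResidue`.
  obtain ⟨k, hk⟩ : ∃ k, 4 * A + 2 ≤ variation (n k) := by
    by_contra! hc
    apply hv
    refine ⟨⌈4 * A + 2⌉, ?_⟩
    rintro _ ⟨k, rfl⟩
    exact_mod_cast ((hc k).trans_le (Int.le_ceil _)).le
  have hk' := hk.trans (variation_le (h.pos k))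
  set M := maxSpectrum (n k) with hM
  set Q := M + 1 with hQ
  have hsum := sum_abs_sub_le_sum_balancedResidue (n k) M
  have hA : A * 2 ^ Q ≤
      ∑ m ∈ Finset.range Q, 2 ^ Q / 2 ^ (m + 1) * |balancedResidue m (n k)| := by
    refine le_trans ?_ hsum
    have : (0 : ℝ) < 2 ^ (M + 1) := by positivity
    nlinarith
  classical
  -- the prescribed signs of the characters
  let σ : ℕ → ℕ → ℝ := fun i p =>
    if i = p / 2 then (-1) ^ p else
      if 0 ≤ balancedResidue (firstDiff (p / 2) i) (n k) then 1 else -1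
  have hσ : ∀ i, IsSign (σ i) := by
    intro i p
    simp only [σ]
    split_ifs
    · exact neg_one_pow_eq_or ℝ _
    · simp
    · simp
  -- Each cell `s` owns two patterns, `p = 2 * s` and `p = 2 * s + 1`. They agree at the points of
  -- the other cells and are opposite at the point of `s` itself.
  choose τ hτ1 hτ2 hτ3 using fun i =>
    h.exists_isSign_chi_eq k (isSign_cellSign i) (hσ i) (2 * 2 ^ Q)
  refine ⟨2 ^ Q, τ, k + 1 + 2 * 2 ^ Q, by positivity, hτ1, fun ρ hρ => ?_⟩
  obtain ⟨s, hs, hsρ⟩ := exists_cellSign_eq Q hρ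
  have hsgn : IsSign fun j => τ s j * ρ j := (hτ1 s).mul hρ
  -- one of the two patterns belonging to `s` gives a nonnegative diagonal term
  have hdiag : ∃ p < 2 * 2 ^ Q, p / 2 = s ∧
      0 ≤ chi (n (k + 1 + p)) ρ * dirichlet (n (k + 1 + p)) (fun j => τ s j * ρ j) := by
    have hp : ∀ p, p < 2 * 2 ^ Q → p / 2 = s → chi (n (k + 1 + p)) (τ s) = (-1) ^ p := by
      intro p hp hps
      rw [hτ3 s p hp]
      simp [σ, hps]
    have hpp : ∀ q : ℕ, chi q ρ * chi q ρ = 1 := fun q => by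
      rcases hρ.chi q with h | h <;> simp [h]
    by_cases hall : ∀ j, τ s j * ρ j = 1
    · have e : 2 * s / 2 = s := by omega
      refine ⟨2 * s, by omega, e, ?_⟩
      rw [dirichlet_of_forall_eq_one hall]
      have h1 := chi_of_forall_eq_one hall (n (k + 1 + 2 * s))
      rw [chi_mul, hp _ (by omega) e] at h1
      simp only [even_two, Even.mul_right, Even.neg_pow, one_pow, one_mul] at h1
      rw [h1]; simp
    · have hex : ∃ j, τ s j * ρ j ≠ 1 := by simpa using hall
      set m := Nat.find hex with hm
      have hlt : ∀ j < m, τ s j * ρ j = 1 := fun j hj => by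
        simpa using Nat.find_min hex hj
      have hmm : τ s m * ρ m = -1 := (hsgn m).resolve_left (Nat.find_spec hex)
      have hval : ∀ p, p < 2 * 2 ^ Q → p / 2 = s →
          chi (n (k + 1 + p)) ρ * dirichlet (n (k + 1 + p)) (fun j => τ s j * ρ j) =
            (-1) ^ p * balancedResidue m (n (k + 1 + p)) := by
        intro p hp1 hp2
        rw [dirichlet_eq_chi_mul hlt hmm, chi_mul, hp p hp1 hp2]
        linear_combination (-1) ^ p * balancedResidue m (n (k + 1 + p)) * hpp (n (k + 1 + p))
      have e : 2 * s / 2 = s := by omega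
      have e' : (2 * s + 1) / 2 = s := by omega
      -- The first difference `m` may lie beyond the common digits. A negative residue forces digit
      -- `m` to be `1`, so `m` is within the spectrum range and the next term has the same residue;
      -- the opposite pattern then reverses the sign.
      by_cases hneg : balancedResidue m (n (k + 1 + 2 * s)) < 0
      · refine ⟨2 * s + 1, by omega, e', ?_⟩
        rw [hval _ (by omega) e']
        have hmem : m ≤ maxSpectrum (n (k + 1 + 2 * s)) :=
          le_maxSpectrum (mem_spectrum.2 (binCoeff_eq_one_of_balancedResidue_neg hneg))
        rw [balancedResidue_congr (b := n (k + 1 + 2 * s))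
          fun j hj => h.binCoeff_eq (by omega) (hj.trans hmem)]
        rw [pow_succ, pow_mul]
        simp only [even_two, Even.neg_pow, one_pow]
        linarith
      · refine ⟨2 * s, by omega, e, ?_⟩
        rw [hval _ (by omega) e]
        simpa using hneg
  obtain ⟨p, hp, hps, hd⟩ := hdiag
  refine ⟨k + 1 + p, by omega, ?_⟩
  have hmain := sum_le_sum_range_two_pow hs (g := fun m => |balancedResidue m (n k)|)
    (G := fun i => chi (n (k + 1 + p)) ρ * dirichlet (n (k + 1 + p)) (fun j => τ i j * ρ j)) hd
    (by
      intro m hm i _ hlt hne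
      have hcell : ∀ j, j ≤ m → τ i j * ρ j = cellSign i j * cellSign s j := by
        intro j hj
        rw [hτ2 i j (by omega), hsρ j (by omega)]
      have h1 : ∀ j < m, τ i j * ρ j = 1 := by
        intro j hj
        rw [hcell j hj.le, cellSign, cellSign, hlt j hj, ← mul_pow]
        simp
      have h2 : τ i m * ρ m = -1 := by
        rw [hcell m le_rfl, cellSign, cellSign]
        rcases binCoeff_eq_zero_or_one m i with h3 | h3 <;>
          rcases binCoeff_eq_zero_or_one m s with h4 | h4 <;> rw [h3, h4] at hne ⊢ <;> simp at hne ⊢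
      rw [dirichlet_eq_chi_mul h1 h2, chi_mul, hτ3 i p hp,
        balancedResidue_congr (a := n (k + 1 + p)) (b := n k) fun j hj => h.binCoeff_eq (by omega) (by omega)]
      have his : i ≠ s := by rintro rfl; exact hne rfl
      have hpp : chi (n (k + 1 + p)) ρ * chi (n (k + 1 + p)) ρ = 1 := by
        rcases hρ.chi (n (k + 1 + p)) with h | h <;> simp [h]
      simp only [σ, hps, his, if_false, firstDiff_eq hlt hne]
      apply le_of_eq
      split_ifs with h5
      · rw [abs_of_nonneg h5]
        linear_combination (-balancedResidue m (n k)) * hpp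
      · rw [abs_of_neg (not_le.1 h5)]
        linear_combination (balancedResidue m (n k)) * hpp)
  push_cast
  refine hA.trans (hmain.trans ?_)
  rw [← Finset.mul_sum]
  refine (le_abs_self _).trans ?_
  rw [abs_mul, hρ.abs_chi, one_mul]

/-! ### Walsh functions -/

theorem walsh_eq_chi (n : ℕ) (x : ℝ) : walsh n x = chi n fun j => rademacher j x := rfl

theorem isSign_rademacher (x : ℝ) : IsSign fun j => rademacher j x := by
  intro j
  simp only [rademacher, rademacherBase]
  split_ifs <;> simp

theorem abs_walsh (n : ℕ) (x : ℝ) : |walsh n x| = 1 := (isSign_rademacher x).abs_chi n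

theorem rademacher_zero (x : ℝ) : rademacher 0 x = rademacherBase x := by simp [rademacher]

theorem rademacher_succ (j : ℕ) (x : ℝ) : rademacher (j + 1) x = rademacher j (2 * x) := by
  rw [rademacher, rademacher, pow_succ, mul_assoc]

theorem walsh_eq_mul (n : ℕ) (x : ℝ) :
    walsh n x = rademacherBase x ^ (n % 2) * walsh (n / 2) (2 * x) := by
  rw [walsh_eq_chi, chi_eq_mul, walsh_eq_chi]
  simp only [rademacher_zero, rademacher_succ]

theorem rademacherBase_periodic : Function.Periodic rademacherBase 1 := fun x => by
  simp [rademacherBase]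

theorem rademacher_periodic (j : ℕ) : Function.Periodic (rademacher j) 1 := fun x => by
  have := rademacherBase_periodic.nat_mul (2 ^ j) (2 ^ j * x)
  simpa [rademacher, mul_add] using this

theorem walsh_periodic (n : ℕ) : Function.Periodic (walsh n) 1 := fun x => by
  simp only [walsh, rademacher_periodic _ x]

theorem measurable_rademacherBase : Measurable rademacherBase :=
  Measurable.ite (measurableSet_lt measurable_fract measurable_const) measurable_const
    measurable_const

theorem measurable_walsh (n : ℕ) : Measurable (walsh n) := by
  apply Finset.measurable_fun_prod
  intro j _
  exact (measurable_rademacherBase.comp (measurable_const.mul measurable_id)).pow_const _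

theorem integrableOn_of_abs_le {g : ℝ → ℝ} (hg : Measurable g) {C : ℝ} (hC : ∀ x, |g x| ≤ C)
    {s : Set ℝ} (hs : volume s ≠ ⊤) : IntegrableOn g s :=
  Measure.integrableOn_of_bounded hs hg.aestronglyMeasurable (Filter.Eventually.of_forall hC)

theorem abs_walsh_mul_walsh (k l : ℕ) (x : ℝ) : |walsh k x * walsh l x| ≤ 1 := by
  rw [abs_mul, abs_walsh, abs_walsh, one_mul]

/-- The integral over `[0, 1)` in terms of the two halves, after rescaling. -/
theorem setIntegral_rademacherBase_pow_mul {g : ℝ → ℝ} (hg : Measurable g)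
    (hp : Function.Periodic g 1) {C : ℝ} (hC : ∀ x, |g x| ≤ C) (a : ℕ) :
    ∫ t in Ico (0 : ℝ) 1, rademacherBase t ^ a * g (2 * t) =
      (1 + (-1) ^ a) / 2 * ∫ t in Ico (0 : ℝ) 1, g t := by
  have hint : ∀ s : Set ℝ, volume s ≠ ⊤ →
      IntegrableOn (fun t => rademacherBase t ^ a * g (2 * t)) s := fun s hs => by
    refine integrableOn_of_abs_le (C := C)
      ((measurable_rademacherBase.pow_const _).mul
        (hg.comp (measurable_const.mul measurable_id))) (fun x => ?_) hs
    have : |rademacherBase x| = 1 := by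
      simp only [rademacherBase]; split_ifs <;> simp
    change |rademacherBase x ^ a * g (2 * x)| ≤ C
    rw [abs_mul, abs_pow, this, one_pow, one_mul]
    exact hC _
  have hsplit : Ico (0 : ℝ) 1 = Ico 0 (1 / 2) ∪ Ico (1 / 2) 1 :=
    (Ico_union_Ico_eq_Ico (by norm_num) (by norm_num)).symm
  have hhalf : ∀ u v : ℝ, u ≤ v → ∫ t in Ico u v, g (2 * t) =
      1 / 2 * ∫ t in (2 * u)..(2 * v), g t := fun u v huv => by
    rw [integral_Ico_eq_integral_Ioc, ← intervalIntegral.integral_of_le huv,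
      intervalIntegral.integral_comp_mul_left g (by norm_num : (2 : ℝ) ≠ 0)]
    simp
  have h1 : ∫ t in Ico (0 : ℝ) (1 / 2), rademacherBase t ^ a * g (2 * t) =
      1 / 2 * ∫ t in Ico (0 : ℝ) 1, g t := by
    rw [setIntegral_congr_fun (g := fun t => g (2 * t)) measurableSet_Ico, hhalf _ _ (by norm_num),
      integral_Ico_eq_integral_Ioc, ← intervalIntegral.integral_of_le (by norm_num)]
    · norm_num
    · intro t ht
      have : Int.fract t = t := Int.fract_eq_self.2 ⟨ht.1, ht.2.trans (by norm_num)⟩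
      simp [rademacherBase, this, show t < 2⁻¹ by simpa using ht.2]
  have h2 : ∫ t in Ico (1 / 2 : ℝ) 1, rademacherBase t ^ a * g (2 * t) =
      (-1) ^ a * (1 / 2 * ∫ t in Ico (0 : ℝ) 1, g t) := by
    have hper := hp.intervalIntegral_add_eq 1 0
    rw [setIntegral_congr_fun (g := fun t => (-1) ^ a * g (2 * t)) measurableSet_Ico,
      integral_const_mul, hhalf _ _ (by norm_num),
      integral_Ico_eq_integral_Ioc, ← intervalIntegral.integral_of_le (by norm_num)]
    · norm_num at hper ⊢
      rw [hper]
    · intro t ht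
      have : Int.fract t = t := Int.fract_eq_self.2 ⟨le_trans (by norm_num) ht.1, ht.2⟩
      simp [rademacherBase, this, show ¬ t < 2⁻¹ by simpa using ht.1]
  rw [hsplit, setIntegral_union (Ico_disjoint_Ico_same) measurableSet_Ico
    (hint _ (by simp)) (hint _ (by simp)), ← hsplit, h1, h2]
  ring

/-- Induction on a common bound `B` for the number of digits: integrating out the first Rademacher
factor gives `0` unless the lowest digits agree. -/
theorem setIntegral_walsh_mul_walsh (k l : ℕ) :
    ∫ t in Ico (0 : ℝ) 1, walsh k t * walsh l t = if k = l then 1 else 0 := by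
  suffices H : ∀ B k l : ℕ, k < 2 ^ B → l < 2 ^ B →
      ∫ t in Ico (0 : ℝ) 1, walsh k t * walsh l t = if k = l then 1 else 0 from
    H (k + l) k l (Nat.lt_two_pow_self.trans_le (Nat.pow_le_pow_right two_pos (by omega)))
      (Nat.lt_two_pow_self.trans_le (Nat.pow_le_pow_right two_pos (by omega)))
  intro B
  induction B with
  | zero =>
    intro k l hk hl
    obtain rfl : k = 0 := by simpa using hk
    obtain rfl : l = 0 := by simpa using hl
    simp [walsh_eq_chi]
  | succ B ih =>
    intro k l hk hl
    have h1 : ∀ t, walsh k t * walsh l t = rademacherBase t ^ (k % 2 + l % 2) *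
        (fun s => walsh (k / 2) s * walsh (l / 2) s) (2 * t) := fun t => by
      rw [walsh_eq_mul k, walsh_eq_mul l, pow_add]; ring
    simp only [h1]
    rw [setIntegral_rademacherBase_pow_mul (g := fun s => walsh (k / 2) s * walsh (l / 2) s)
      ((measurable_walsh _).mul (measurable_walsh _))
      (fun x => by simp only [walsh_periodic _ x]) (abs_walsh_mul_walsh _ _),
      ih (k / 2) (l / 2) (by rw [pow_succ] at hk; omega) (by rw [pow_succ] at hl; omega)]
    rcases Nat.mod_two_eq_zero_or_one k with hk2 | hk2 <;>
      rcases Nat.mod_two_eq_zero_or_one l with hl2 | hl2 <;> rw [hk2, hl2] <;> norm_num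
    · congr 1
      apply propext; omega
    · omega
    · omega
    · congr 1
      apply propext; omega

/-! ### Walsh polynomials with large partial sums -/

/-- The Walsh polynomial with coefficients `c k`, `k < D`. -/
noncomputable def walshPoly (D : ℕ) (c : ℕ → ℝ) (x : ℝ) : ℝ :=
  ∑ k ∈ Finset.range D, c k * walsh k x

theorem measurable_walshPoly (D : ℕ) (c : ℕ → ℝ) : Measurable (walshPoly D c) :=
  Finset.measurable_fun_sum _ fun k _ => (measurable_walsh k).const_mul _

theorem abs_walshPoly_le {D : ℕ} {c : ℕ → ℝ} (hc : ∀ k, |c k| ≤ 1) (x : ℝ) :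
    |walshPoly D c x| ≤ D := by
  refine (Finset.abs_sum_le_sum_abs _ _).trans ?_
  refine (Finset.sum_le_sum (g := fun _ => (1 : ℝ)) fun k _ => ?_).trans (by simp)
  rw [abs_mul, abs_walsh, mul_one]
  exact hc k

theorem abs_walshPoly_le_of_eq_zero {D : ℕ} {c : ℕ → ℝ} (hc : ∀ k, |c k| ≤ 1)
    (hD : ∀ k, D ≤ k → c k = 0) (n : ℕ) (x : ℝ) : |walshPoly n c x| ≤ D := by
  rcases le_total n D with h | h
  · exact (abs_walshPoly_le hc x).trans (by exact_mod_cast h)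
  · have : walshPoly n c x = walshPoly D c x := by
      symm
      apply Finset.sum_subset (Finset.range_mono h)
      intro k _ hk
      rw [hD k (by simpa using hk), zero_mul]
    rw [this]
    exact abs_walshPoly_le hc x

theorem coeff_walshPoly {D : ℕ} {c : ℕ → ℝ} (hD : ∀ k, D ≤ k → c k = 0) (k : ℕ) :
    coeff (walshPoly D c) k = c k := by
  simp only [coeff, walshPoly, Finset.sum_mul, mul_assoc]
  rw [integral_finsetSum]
  · simp only [integral_const_mul, setIntegral_walsh_mul_walsh]
    by_cases hk : k < D
    · simp [hk]
    · simp [hk, hD k (not_lt.1 hk)]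
  · intro i _
    exact (integrableOn_of_abs_le ((measurable_walsh _).mul (measurable_walsh _))
      (abs_walsh_mul_walsh _ _) (by simp)).const_mul _

theorem setIntegral_walshPoly {D : ℕ} {c : ℕ → ℝ} (hD : ∀ k, D ≤ k → c k = 0) :
    ∫ t in Ico (0 : ℝ) 1, walshPoly D c t = c 0 := by
  rw [← coeff_walshPoly hD 0, coeff]
  simp [walsh_eq_chi]

/-- Nonnegative Walsh polynomials of integral `1` with large partial sums everywhere. -/
theorem NestedSpectrums.exists_walshPoly {n : ℕ → ℕ} (h : NestedSpectrums n)
    (hv : UnboundedVariation n) (A : ℝ) :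
    ∃ (D : ℕ) (c : ℕ → ℝ), (∀ k, |c k| ≤ 1) ∧ (∀ k, D ≤ k → c k = 0) ∧ c 0 = 1 ∧
      (∀ x, 0 ≤ walshPoly D c x) ∧ ∀ x, ∃ k, n k ≤ D ∧ A ≤ |walshPoly (n k) c x| := by
  obtain ⟨N, τ, K, hN, hτ, hA⟩ := h.exists_points hv A
  have hN' : (0 : ℝ) < N := by exact_mod_cast hN
  -- A power of two makes the truncated kernels nonnegative; this one also exceeds every index `n k`
  -- with `k ≤ K`.
  set D := 2 ^ n K with hD
  let c : ℕ → ℝ := fun k => if k < D then (∑ i ∈ Finset.range N, chi k (τ i)) / N else 0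
  have hpoly : ∀ m ≤ D, ∀ x, walshPoly m c x =
      (∑ i ∈ Finset.range N, dirichlet m (fun j => τ i j * rademacher j x)) / N := by
    intro m hm x
    simp only [walshPoly, dirichlet, chi_mul, ← walsh_eq_chi]
    rw [Finset.sum_comm, Finset.sum_div]
    apply Finset.sum_congr rfl
    intro k hk
    have : k < D := (Finset.mem_range.1 hk).trans_le hm
    simp only [c, this, if_true]
    rw [← Finset.sum_mul]
    ring
  refine ⟨D, c, fun k => ?_, fun k hk => by simp [c, hk], ?_, fun x => ?_, fun x => ?_⟩
  · simp only [c]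
    split_ifs
    · rw [abs_div, abs_of_pos hN', div_le_one hN']
      refine (Finset.abs_sum_le_sum_abs _ _).trans ?_
      simp [(hτ _).abs_chi]
    · simp
  · have : 0 < D := by positivity
    simp [c, this, hN'.ne']
  · rw [hpoly D le_rfl]
    apply div_nonneg (Finset.sum_nonneg fun i _ => ?_) hN'.le
    exact dirichlet_two_pow_nonneg _ ((hτ i).mul (isSign_rademacher x))
  · obtain ⟨k, hk, hAk⟩ := hA _ (isSign_rademacher x)
    have hkD : n k ≤ D := (h.strictMono.monotone hk).trans Nat.lt_two_pow_self.le
    refine ⟨k, hkD, ?_⟩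
    rwa [hpoly _ hkD, abs_div, abs_of_pos hN', le_div_iff₀ hN']

/-! ### The gliding hump -/

/-- The weights of the gliding hump: `δ i` is tiny compared to the degrees `D (A j)`, `j < i`, of
the previous humps, and `A i` makes up for this and for the contribution of these humps. -/
theorem exists_weights (D : ℝ → ℕ) :
    ∃ δ A : ℕ → ℝ, (∀ i, 0 < δ i) ∧ (δ 0 = 1) ∧
      (∀ i, 2 * (1 + D (A i)) * δ (i + 1) = δ i) ∧
      ∀ i, δ i * A i = i + ∑ j ∈ Finset.range i, δ j * D (A j) + 2 := by
  let amp : ℕ → ℝ × ℝ → ℝ := fun i p => (i + p.2 + 2) / p.1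
  -- The state is the pair of `δ i` and the sum of `δ j * D (A j)` over `j < i`; together they
  -- determine `A i`.
  let s : ℕ → ℝ × ℝ := fun i => Nat.rec (1, 0)
    (fun i p => (p.1 / (2 * (1 + D (amp i p))), p.2 + p.1 * D (amp i p))) i
  have hpos : ∀ i, 0 < (s i).1 := by
    intro i
    induction i with
    | zero => exact one_pos
    | succ i ih => exact div_pos ih (by positivity)
  have hsum : ∀ i, (s i).2 = ∑ j ∈ Finset.range i, (s j).1 * D (amp j (s j)) := by
    intro i
    induction i with
    | zero => rfl
    | succ i ih => rw [Finset.sum_range_succ, ← ih]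
  refine ⟨fun i => (s i).1, fun i => amp i (s i), hpos, rfl, fun i => ?_, fun i => ?_⟩
  · exact mul_div_cancel₀ _ (by positivity)
  · rw [← hsum i]
    exact mul_div_cancel₀ _ (hpos i).ne'

theorem NestedSpectrums.exists_unboundedEverywhere {n : ℕ → ℕ} (h : NestedSpectrums n)
    (hv : UnboundedVariation n) :
    ∃ f : ℝ → ℝ, IntegrableOn f (Ico (0 : ℝ) 1) ∧ UnboundedEverywhereAlong n f := by
  choose D₀ c₀ hc₀ hD₀ h0₀ hnn₀ hlarge₀ using fun A => h.exists_walshPoly hv A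
  obtain ⟨δ, A, hδ, hδ0, hδs, hA⟩ := exists_weights D₀
  set D : ℕ → ℕ := fun i => D₀ (A i)
  set c : ℕ → ℕ → ℝ := fun i => c₀ (A i)
  have hc : ∀ i k, |c i k| ≤ 1 := fun i => hc₀ (A i)
  have hD : ∀ i k, D i ≤ k → c i k = 0 := fun i => hD₀ (A i)
  have hδs' : ∀ i, 2 * (1 + (D i : ℝ)) * δ (i + 1) = δ i := hδs
  have hhalf : ∀ i, δ (i + 1) ≤ δ i * (1 / 2) := fun i => by
    rw [← hδs' i]
    have := mul_nonneg (Nat.cast_nonneg (α := ℝ) (D i)) (hδ (i + 1)).le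
    nlinarith
  have hgeom : ∀ i j, δ (i + j) ≤ δ i * (1 / 2) ^ j := by
    intro i j
    induction j with
    | zero => simp
    | succ j ih =>
      rw [← add_assoc, pow_succ]
      linarith [hhalf (i + j)]
  have hδsum : Summable δ := by
    refine Summable.of_nonneg_of_le (fun i => (hδ i).le) (fun i => ?_) summable_geometric_two
    simpa [hδ0] using hgeom 0 i
  let F : ℕ → ℝ → ℝ := fun i x => δ i * walshPoly (D i) (c i) x
  have hF0 : ∀ i x, 0 ≤ F i x := fun i x => mul_nonneg (hδ i).le (hnn₀ (A i) x)
  have hFm : ∀ i, Measurable (F i) := fun i => (measurable_walshPoly _ _).const_mul _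
  have hFi : ∀ i, IntegrableOn (F i) (Ico 0 1) := fun i =>
    (integrableOn_of_abs_le (measurable_walshPoly _ _) (abs_walshPoly_le (hc i))
      (by simp)).const_mul _
  have hFint : ∀ i, ∫ x in Ico (0 : ℝ) 1, F i x = δ i := fun i => by
    simp only [F]
    rw [integral_const_mul, setIntegral_walshPoly (hD i)]
    simp [c, h0₀]
  let f : ℝ → ℝ := fun x => ∑' i, F i x
  have hf : IntegrableOn f (Ico (0 : ℝ) 1) := by
    -- This holds at points of divergence too, where both sides take the default value `0`.
    have hf' : f = fun x => (∑' i, ENNReal.ofReal (F i x)).toReal := by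
      funext x
      rw [ENNReal.tsum_toReal_eq fun i => ENNReal.ofReal_ne_top]
      simp only [f, ENNReal.toReal_ofReal (hF0 _ x)]
    rw [hf']
    apply integrable_toReal_of_lintegral_ne_top
    · exact (Measurable.tsum fun i => (hFm i).ennreal_ofReal).aemeasurable
    · rw [lintegral_tsum fun i => (hFm i).ennreal_ofReal.aemeasurable]
      have : ∀ i, ∫⁻ x in Ico (0 : ℝ) 1, ENNReal.ofReal (F i x) = ENNReal.ofReal (δ i) :=
        fun i => by
          rw [← ofReal_integral_eq_lintegral_ofReal (hFi i)
            (Filter.Eventually.of_forall (hF0 i)), hFint]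
      simp only [this]
      exact hδsum.tsum_ofReal_ne_top
  have hcoeff : ∀ k, HasSum (fun i => δ i * c i k) (coeff f k) := by
    intro k
    have h1 : ∀ i, IntegrableOn (fun x => F i x * walsh k x) (Ico 0 1) := fun i =>
      (hFi i).mul_bdd (c := 1) (measurable_walsh k).aestronglyMeasurable
        (Filter.Eventually.of_forall fun x => (abs_walsh k x).le)
    have h2 := hasSum_integral_of_summable_integral_norm h1 (by
      have : ∀ i, ∫ x in Ico (0 : ℝ) 1, ‖F i x * walsh k x‖ = δ i := fun i => by
        rw [← hFint i]
        congr 1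
        funext x
        rw [norm_mul, Real.norm_eq_abs, Real.norm_eq_abs, abs_walsh, mul_one,
          abs_of_nonneg (hF0 i x)]
      simpa only [this] using hδsum)
    have h3 : ∀ i, ∫ x in Ico (0 : ℝ) 1, F i x * walsh k x = δ i * c i k := fun i => by
      simp only [F, mul_assoc]
      rw [integral_const_mul]
      congr 1
      exact coeff_walshPoly (hD i) k
    simp only [h3, tsum_mul_right] at h2
    exact h2
  have hpartial : ∀ m x, HasSum (fun i => δ i * walshPoly m (c i) x) (partialSum m f x) := by
    intro m x
    simp only [partialSum, walshPoly, Finset.mul_sum, ← mul_assoc]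
    exact hasSum_sum fun k _ => (hcoeff k).mul_right _
  refine ⟨f, hf, fun x _ => ?_⟩
  rintro ⟨C, hC⟩
  obtain ⟨i, hi⟩ := exists_nat_gt C
  obtain ⟨k, hk, hAk⟩ := hlarge₀ (A i) x
  have hCk : |partialSum (n k) f x| ≤ C := hC ⟨k, rfl⟩
  have hs := hpartial (n k) x
  have hsplit := hs.summable.sum_add_tsum_nat_add (i + 1)
  rw [hs.tsum_eq, Finset.sum_range_succ] at hsplit
  have hhead : |∑ j ∈ Finset.range i, δ j * walshPoly (n k) (c j) x| ≤
      ∑ j ∈ Finset.range i, δ j * D j := by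
    refine (Finset.abs_sum_le_sum_abs _ _).trans (Finset.sum_le_sum fun j _ => ?_)
    rw [abs_mul, abs_of_pos (hδ j)]
    exact mul_le_mul_of_nonneg_left (abs_walshPoly_le_of_eq_zero (hc j) (hD j) _ _) (hδ j).le
  -- Later humps are bounded by the number `n k ≤ D i` of terms, and `δ (i + 1) * D i ≤ 1 / 2` by
  -- the choice of weights.
  have htail : |∑' j, δ (j + (i + 1)) * walshPoly (n k) (c (j + (i + 1))) x| ≤ 1 := by
    refine tsum_of_norm_bounded (f := fun j => δ (j + (i + 1)) * walshPoly (n k) (c (j + (i + 1))) x)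
      (g := fun j : ℕ => 1 / 2 * (1 / 2 : ℝ) ^ j) ?_ fun j => ?_
    · simpa using hasSum_geometric_two.mul_left (1 / 2 : ℝ)
    · have h1 : δ i ≤ 1 := by simpa [hδ0] using (hgeom 0 i).trans (by
        rw [hδ0, one_mul]; exact pow_le_one₀ (by norm_num) (by norm_num))
      have h2 : (n k : ℝ) ≤ D i := by exact_mod_cast hk
      have h3 : δ (i + 1) * D i ≤ 1 / 2 := by linarith [hδs' i, hδ (i + 1)]
      rw [Real.norm_eq_abs, abs_mul, abs_of_pos (hδ _), add_comm j]
      calc δ (i + 1 + j) * |walshPoly (n k) (c (i + 1 + j)) x|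
          ≤ (δ (i + 1) * (1 / 2) ^ j) * D i := by
            apply mul_le_mul (hgeom _ _) ((abs_walshPoly_le (hc _) x).trans h2) (abs_nonneg _)
            exact mul_nonneg (hδ _).le (by positivity)
        _ = δ (i + 1) * D i * (1 / 2) ^ j := by ring
        _ ≤ _ := by gcongr
  have hmid : δ i * A i ≤ |δ i * walshPoly (n k) (c i) x| := by
    rw [abs_mul, abs_of_pos (hδ i)]
    exact mul_le_mul_of_nonneg_left hAk (hδ i).le
  have hAi : δ i * A i = i + ∑ j ∈ Finset.range i, δ j * (D j : ℝ) + 2 := hA i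
  rw [hAi] at hmid
  rw [← hsplit] at hCk
  rw [abs_le] at hhead htail hCk
  -- Hump `i` exceeds head and tail together by at least `i + 1`, hence by more than `C`.
  rcases le_abs.1 hmid with h1 | h1 <;> linarith [hhead.1, hhead.2, htail.1, htail.2, hCk.1, hCk.2]

/-! ### Bounded perturbations of the indices -/

theorem abs_coeff_le (f : ℝ → ℝ) (k : ℕ) : |coeff f k| ≤ ∫ t in Ico (0 : ℝ) 1, |f t| := by
  have h := norm_integral_le_integral_norm (μ := volume.restrict (Ico (0 : ℝ) 1))
    fun t => f t * walsh k t
  simpa only [coeff, norm_mul, Real.norm_eq_abs, abs_walsh, mul_one] using h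

theorem abs_partialSum_sub_le (f : ℝ → ℝ) (x : ℝ) (a b : ℕ) :
    |partialSum a f x - partialSum b f x| ≤
      |(a : ℝ) - b| * ∫ t in Ico (0 : ℝ) 1, |f t| := by
  wlog h : b ≤ a generalizing a b
  · rw [abs_sub_comm, abs_sub_comm (a : ℝ)]
    exact this b a (not_le.1 h).le
  rw [partialSum, partialSum, ← Finset.sum_Ico_eq_sub _ h]
  refine (Finset.abs_sum_le_sum_abs _ _).trans ?_
  refine (Finset.sum_le_sum (g := fun _ => ∫ t in Ico (0 : ℝ) 1, |f t|) fun k _ => ?_).trans ?_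
  · rw [abs_mul, abs_walsh, mul_one]
    exact abs_coeff_le f k
  · rw [Finset.sum_const, Nat.card_Ico, nsmul_eq_mul, Nat.cast_sub h,
      abs_of_nonneg (sub_nonneg.2 (by exact_mod_cast h))]

theorem UnboundedEverywhereAlong.of_close {m n φ : ℕ → ℕ} (h : Close (m ∘ φ) n) {f : ℝ → ℝ}
    (hf : UnboundedEverywhereAlong n f) : UnboundedEverywhereAlong m f := by
  obtain ⟨C, hC⟩ := h
  intro x hx
  rintro ⟨B, hB⟩
  refine hf x hx ⟨B + C * ∫ t in Ico (0 : ℝ) 1, |f t|, ?_⟩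
  rintro _ ⟨k, rfl⟩
  have h1 : |partialSum (m (φ k)) f x| ≤ B := hB ⟨φ k, rfl⟩
  have h2 := abs_partialSum_sub_le f x (m (φ k)) (n k)
  have h3 : |(m (φ k) : ℝ) - n k| ≤ C := by exact_mod_cast hC k
  have h4 : |(m (φ k) : ℝ) - n k| * ∫ t in Ico (0 : ℝ) 1, |f t| ≤
      C * ∫ t in Ico (0 : ℝ) 1, |f t| :=
    mul_le_mul_of_nonneg_right h3 (integral_nonneg fun t => abs_nonneg _)
  have h5 := abs_sub_abs_le_abs_sub (partialSum (n k) f x) (partialSum (m (φ k)) f x)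
  rw [abs_sub_comm] at h5
  dsimp only
  linarith

/-! ### Sparse sequences -/

theorem binCoeff_add_two_pow {n e : ℕ} (h : n < 2 ^ e) (j : ℕ) :
    binCoeff j (n + 2 ^ e) = if j = e then 1 else binCoeff j n := by
  rcases lt_trichotomy j e with hj | rfl | hj
  · obtain ⟨d, rfl⟩ := Nat.exists_eq_add_of_lt hj
    have : n + 2 ^ (j + d + 1) = n + 2 ^ j * (2 * 2 ^ d) := by ring
    rw [if_neg (by omega), binCoeff, binCoeff, this, Nat.add_mul_div_left _ _ (by positivity)]
    omega
  · rw [if_pos rfl, binCoeff, Nat.add_div_right _ (by positivity), Nat.div_eq_of_lt h]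
  · have h1 : n + 2 ^ e < 2 ^ j := by
      have : 2 ^ (e + 1) ≤ 2 ^ j := Nat.pow_le_pow_right two_pos hj
      rw [pow_succ] at this
      omega
    rw [if_neg (by omega), binCoeff, binCoeff, Nat.div_eq_of_lt h1, Nat.div_eq_of_lt (by omega)]

theorem spectrum_add_two_pow_inter {n e : ℕ} (h : n < e) :
    spectrum (n + 2 ^ e) ∩ Finset.Icc 0 (maxSpectrum n) = spectrum n := by
  have h2 : n < 2 ^ e := h.trans Nat.lt_two_pow_self
  ext j
  rw [Finset.mem_inter, Finset.mem_Icc, mem_spectrum, binCoeff_add_two_pow h2]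
  constructor
  · rintro ⟨h3, -, h4⟩
    have h5 : maxSpectrum n ≤ n := Finset.sup_le fun i hi =>
      (Finset.mem_range.1 (Finset.mem_filter.1 hi).1).le
    rw [if_neg (by omega)] at h3
    exact mem_spectrum.2 h3
  · intro h3
    have h4 := Finset.mem_range.1 (Finset.mem_filter.1 h3).1
    rw [if_neg (by omega)]
    exact ⟨mem_spectrum.1 h3, Nat.zero_le _, le_maxSpectrum h3⟩

/-- Since `n < e`, digit `e - 1` of the sum is `0`, so the new top digit adds a jump not counted
among those of `n`. -/
theorem variation_add_one_le {n e : ℕ} (h : n < e) :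
    variation n + 1 ≤ variation (n + 2 ^ e) := by
  have h2 : n < 2 ^ e := h.trans Nat.lt_two_pow_self
  obtain ⟨d, rfl⟩ : ∃ d, e = d + 1 := ⟨e - 1, by omega⟩
  have hd : d + 1 < 2 ^ (d + 1) := Nat.lt_two_pow_self
  have hsub : insert d (Finset.range n) ⊆ Finset.range (n + 2 ^ (d + 1)) := by
    intro j
    simp only [Finset.mem_insert, Finset.mem_range]
    omega
  have hle := Finset.sum_le_sum_of_subset_of_nonneg hsub
    (f := fun j => |(binCoeff (j + 1) (n + 2 ^ (d + 1)) : ℤ) - binCoeff j (n + 2 ^ (d + 1))|)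
    fun _ _ _ => abs_nonneg _
  rw [Finset.sum_insert (by simp; omega)] at hle
  have hsum : ∑ j ∈ Finset.range n,
      |(binCoeff (j + 1) (n + 2 ^ (d + 1)) : ℤ) - binCoeff j (n + 2 ^ (d + 1))| =
      ∑ j ∈ Finset.range n, |(binCoeff (j + 1) n : ℤ) - binCoeff j n| := by
    apply Finset.sum_congr rfl
    intro j hj
    have := Finset.mem_range.1 hj
    rw [binCoeff_add_two_pow h2, binCoeff_add_two_pow h2, if_neg (by omega), if_neg (by omega)]
  have htop : |(binCoeff (d + 1) (n + 2 ^ (d + 1)) : ℤ) - binCoeff d (n + 2 ^ (d + 1))| = 1 := by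
    rw [binCoeff_add_two_pow h2, binCoeff_add_two_pow h2, if_pos rfl, if_neg (by omega),
      binCoeff_eq_zero (by omega)]
    simp
  rw [hsum, htop] at hle
  have h0 : binCoeff 0 (n + 2 ^ (d + 1)) = binCoeff 0 n := by
    rw [binCoeff_add_two_pow h2, if_neg (by omega)]
  rw [variation, variation, h0]
  linarith

/-- Arbitrarily sparse sequences with nested spectrums and unbounded variation. -/
theorem exists_sparse_nestedSpectrums (l : ℕ → ℝ) :
    ∃ n : ℕ → ℕ, NestedSpectrums n ∧ UnboundedVariation n ∧
      ∀ k, l k ≤ (n (k + 1) : ℝ) / (n k : ℝ) := by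
  -- The part `a + 1` keeps the new digit clear of the old ones; the ceiling gives the growth, as `2
  -- ^ e` exceeds `e`.
  let e : ℕ → ℕ → ℕ := fun k a => a + 1 + ⌈l k * a⌉₊
  obtain ⟨n, hzero, hsucc⟩ : ∃ n : ℕ → ℕ, n 0 = 1 ∧ ∀ k, n (k + 1) = n k + 2 ^ e k (n k) :=
    ⟨fun k => Nat.rec 1 (fun k a => a + 2 ^ e k a) k, rfl, fun _ => rfl⟩
  have he : ∀ k, n k < e k (n k) := fun k => by simp only [e]; omega
  have hmono : StrictMono n := strictMono_nat_of_lt_succ fun k => by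
    rw [hsucc]
    exact Nat.lt_add_of_pos_right (by positivity)
  have hpos : ∀ k, 0 < n k := fun k =>
    (show 0 < n 0 by omega).trans_le (hmono.monotone (Nat.zero_le k))
  have hvar : ∀ k : ℕ, (k : ℤ) ≤ variation (n k) := by
    intro k
    induction k with
    | zero =>
      rw [variation]
      push_cast
      positivity
    | succ k ih =>
      have := variation_add_one_le (he k)
      rw [hsucc]
      push_cast
      linarith
  refine ⟨n, ⟨hpos, hmono, fun k => by rw [hsucc]; exact spectrum_add_two_pow_inter (he k)⟩, ?_, fun k => ?_⟩
  · rintro ⟨C, hC⟩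
    have h1 : variation (n (C.toNat + 1)) ≤ C := hC ⟨C.toNat + 1, rfl⟩
    have h2 := hvar (C.toNat + 1)
    have h3 := Int.self_le_toNat C
    push_cast at h2
    linarith
  · rw [le_div_iff₀ (by exact_mod_cast hpos k)]
    have h1 : l k * n k ≤ (⌈l k * n k⌉₊ : ℝ) := Nat.le_ceil _
    have h2 : ⌈l k * n k⌉₊ ≤ n (k + 1) := by
      have : e k (n k) < 2 ^ e k (n k) := Nat.lt_two_pow_self
      rw [hsucc]
      have h4 : ⌈l k * n k⌉₊ ≤ e k (n k) := Nat.le_add_left _ _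
      omega
    exact h1.trans (by exact_mod_cast h2)

end Walsh

theorem theorem1 :
    -- sequences with nested spectrums and unbounded variation
    (∀ n : ℕ → ℕ, Walsh.NestedSpectrums n → Walsh.UnboundedVariation n →
      ∃ f : ℝ → ℝ, IntegrableOn f (Ico (0 : ℝ) 1) ∧ Walsh.UnboundedEverywhereAlong n f) ∧
    -- sequences containing a subsequence that is close to such a sequence
    (∀ (m φ n : ℕ → ℕ), StrictMono φ → Walsh.NestedSpectrums n → Walsh.UnboundedVariation n →
      Walsh.Close (m ∘ φ) n →
      ∃ f : ℝ → ℝ, IntegrableOn f (Ico (0 : ℝ) 1) ∧ Walsh.UnboundedEverywhereAlong m f) ∧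
    -- arbitrarily sparse sequences
    (∀ l : ℕ → ℝ, (∀ k, 0 < l k) →
      ∃ (f : ℝ → ℝ) (n : ℕ → ℕ), IntegrableOn f (Ico (0 : ℝ) 1) ∧
        (∀ k, 0 < n k) ∧ StrictMono n ∧ (∀ k, l k ≤ (n (k + 1) : ℝ) / (n k : ℝ)) ∧
        Walsh.UnboundedEverywhereAlong n f) := by
  refine ⟨fun n h hv => h.exists_unboundedEverywhere hv, fun m φ n _ h hv hc => ?_,
    fun l _ => ?_⟩
  · obtain ⟨f, hf, hu⟩ := h.exists_unboundedEverywhere hv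
    exact ⟨f, hf, hu.of_close hc⟩
  · obtain ⟨n, h, hv, hl⟩ := Walsh.exists_sparse_nestedSpectrums l
    obtain ⟨f, hf, hu⟩ := h.exists_unboundedEverywhere hv
    exact ⟨f, n, hf, h.pos, h.strictMono, hl, hu⟩
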